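/- Let $R$ be a commutative Noetherian ring with identity, $\mathfrak a$ an ideal of $R$, $X$ an (arbitrary) $R$-module and $n\ge 0$ an integer. Let $H^i_{\mathfrak a}$ denote the $i$-th local cohomology functor, i.e. the $i$-th right derived functor of the $\mathfrak a$-torsion functor $\Gamma_{\mathfrak a}(M)=\bigcup_{k\ge 0}(0:_M\mathfrak a^k)$. An $R$-module $M$ is called weakly Laskerian if $\operatorname{Ass}_R(M/M')$ is finite for every submodule $M'\subseteq M$. Suppose that (i) $\operatorname{Ext}^n_R(R/\mathfrak a, X)$ is weakly Laskerian, and (ii) $\operatorname{Ext}^{n+1-i}_R(R/\mathfrak a, H^i_{\mathfrak a}(X))$ is weakly Laskerian for all integers $i$ with $0\le i<n$. Then $\operatorname{Hom}_R(R/\mathfrak a, H^n_{\mathfrak a}(X))$ is weakly Laskerian, and hence $\operatorname{Ass}_R(H^n_{\mathfrak a}(X))$ is finite. -/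

import Mathlib

open CategoryTheory

universe u

/-- An `R`-module `M` is weakly Laskerian if every quotient module of `M` has only finitely many
associated primes.  (Mathlib's `associatedPrimes` uses the radical of the annihilator of an
element; over a Noetherian ring this is the usual notion, see `isAssociatedPrime_iff`.) -/
def IsWeaklyLaskerian (R : Type*) [CommRing R] (M : Type*) [AddCommGroup M] [Module R M] : Prop :=
  ∀ N : Submodule R M, (associatedPrimes R (M ⧸ N)).Finite

/-- The `a`-torsion submodule `Γ_a(M) = ⋃ₙ (0 :_M aⁿ)` of an `R`-module `M`: the elements
annihilated by some power of the ideal `a`. -/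
def gammaTorsion {R : Type*} [CommRing R] (a : Ideal R) (M : Type*) [AddCommGroup M]
    [Module R M] : Submodule R M where
  carrier := {x | ∃ n : ℕ, ∀ r ∈ a ^ n, r • x = 0}
  zero_mem' := ⟨0, fun r _ => smul_zero r⟩
  add_mem' := by
    rintro x y ⟨m, hm⟩ ⟨n, hn⟩
    refine ⟨max m n, fun r hr => ?_⟩
    rw [smul_add, hm r (Ideal.pow_le_pow_right (le_max_left m n) hr),
      hn r (Ideal.pow_le_pow_right (le_max_right m n) hr), add_zero]
  smul_mem' := by
    rintro c x ⟨n, hn⟩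
    refine ⟨n, fun r hr => ?_⟩
    rw [smul_comm, hn r hr, smul_zero]

/-- A linear map sends `Γ_a(M)` into `Γ_a(N)`. -/
theorem gammaTorsion_map_mem {R : Type*} [CommRing R] (a : Ideal R) {M N : Type*}
    [AddCommGroup M] [Module R M] [AddCommGroup N] [Module R N] (f : M →ₗ[R] N) :
    ∀ x ∈ gammaTorsion a M, f x ∈ gammaTorsion a N := by
  rintro x ⟨n, hn⟩
  exact ⟨n, fun r hr => by rw [← map_smul, hn r hr, map_zero]⟩

/-- The `a`-torsion functor `Γ_a` on `R`-modules; on morphisms it is restriction. -/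
def gammaFunctor {R : Type u} [CommRing R] (a : Ideal R) : ModuleCat.{u} R ⥤ ModuleCat.{u} R where
  obj M := ModuleCat.of R (gammaTorsion a M)
  map f := ModuleCat.ofHom (f.hom.restrict (gammaTorsion_map_mem a f.hom))

instance gammaFunctor_additive {R : Type u} [CommRing R] (a : Ideal R) :
    (gammaFunctor a).Additive where

/-- The `i`-th local cohomology module `H^i_a(X)`: the value at `X` of the `i`-th right derived
functor of the `a`-torsion functor `Γ_a`. -/
noncomputable def localCohomologyModule {R : Type u} [CommRing R] (a : Ideal R) (i : ℕ)
    (X : ModuleCat.{u} R) : ModuleCat.{u} R :=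
  ((gammaFunctor a).rightDerived i).obj X

/-! Let `I` be an injective resolution of `X` and `D = Γ_a(I)`, with cocycles Z, coboundaries B and
cohomology H = H_a(X). From 0 → Bⁿ → Zⁿ → Hⁿ → 0, Hom(R/a, Hⁿ) is an extension of a submodule of
Ext¹(R/a, Bⁿ) by the image of Hom(R/a, Zⁿ). By Artin–Rees the terms of `D` are injective, so
dimension shifting bounds Ext¹(R/a, Bⁿ) by hypothesis (ii). The image is a subquotient of Extⁿ(R/a,
X): a map R/a → Zⁿ whose class there vanishes lifts to Iⁿ⁻¹, and the lift, having source R/a, lands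
in Γ_a(Iⁿ⁻¹). Finally Ass Hⁿ ⊆ Ass Hom(R/a, Hⁿ), as Hⁿ is torsion. -/

namespace IsWeaklyLaskerian

variable {R : Type*} [CommRing R] {M N P : Type*} [AddCommGroup M] [Module R M]
  [AddCommGroup N] [Module R N] [AddCommGroup P] [Module R P]

/-- For `S ≤ N`, the sequence 0 → M/f⁻¹(S) → N/S → P/g(S) is exact. With an end term zero this gives
closure under submodules and quotients. -/
theorem of_exact {f : M →ₗ[R] N} {g : N →ₗ[R] P} (hfg : Function.Exact f g)
    (hM : IsWeaklyLaskerian R M) (hP : IsWeaklyLaskerian R P) : IsWeaklyLaskerian R N := by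
  intro S
  refine ((hM (S.comap f)).union (hP (S.map g))).subset
    (associatedPrimes.subset_union_of_exact
      (f := Submodule.mapQ (S.comap f) S f le_rfl)
      (g := Submodule.mapQ S (S.map g) g (Submodule.le_comap_map g S)) ?_ ?_)
  · rw [← LinearMap.ker_eq_bot, Submodule.ker_mapQ, Submodule.mkQ_map_self]
  · intro y
    obtain ⟨y, rfl⟩ := S.mkQ_surjective y
    simp only [Submodule.mkQ_apply, Submodule.mapQ_apply, Submodule.Quotient.mk_eq_zero,
      Submodule.mem_map, Set.mem_range]
    constructor
    · rintro ⟨s, hs, hsy⟩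
      obtain ⟨m, hm⟩ := (hfg (y - s)).1 (by rw [map_sub, hsy, sub_self])
      refine ⟨Submodule.Quotient.mk m, ?_⟩
      rw [Submodule.mapQ_apply, Submodule.Quotient.eq, hm]
      simpa using hs
    · rintro ⟨x, hx⟩
      obtain ⟨m, rfl⟩ := (S.comap f).mkQ_surjective x
      rw [Submodule.mkQ_apply, Submodule.mapQ_apply, Submodule.Quotient.eq] at hx
      refine ⟨y - f m, ?_, ?_⟩
      · simpa using S.neg_mem hx
      · rw [map_sub, hfg.apply_apply_eq_zero, sub_zero]

theorem of_subsingleton [Subsingleton M] : IsWeaklyLaskerian R M := fun N => by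
  rw [associatedPrimes.eq_empty_of_subsingleton]
  exact Set.finite_empty

theorem of_injective (f : M →ₗ[R] N) (hf : Function.Injective f) (hN : IsWeaklyLaskerian R N) :
    IsWeaklyLaskerian R M :=
  of_exact (f := (0 : PUnit →ₗ[R] M)) (g := f)
    ((LinearMap.exact_zero_iff_injective PUnit f).2 hf) of_subsingleton hN

theorem of_surjective (f : M →ₗ[R] N) (hf : Function.Surjective f) (hM : IsWeaklyLaskerian R M) :
    IsWeaklyLaskerian R N :=
  of_exact (f := f) (g := (0 : N →ₗ[R] PUnit))
    ((LinearMap.exact_zero_iff_surjective PUnit f).2 hf) hM of_subsingleton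

/-- The range is a quotient of `M ⧸ ker θ`, which embeds in `P`. -/
theorem range_of_ker_le {φ : M →ₗ[R] N} {θ : M →ₗ[R] P} (h : LinearMap.ker θ ≤ LinearMap.ker φ)
    (hP : IsWeaklyLaskerian R P) : IsWeaklyLaskerian R (LinearMap.range φ) := by
  have hq : IsWeaklyLaskerian R (M ⧸ LinearMap.ker θ) :=
    of_injective ((LinearMap.ker θ).liftQ θ le_rfl)
      (LinearMap.ker_eq_bot.1 (Submodule.ker_liftQ_eq_bot' _ _ rfl)) hP
  refine of_surjective ((LinearMap.ker θ).liftQ φ.rangeRestrict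
    (by rwa [LinearMap.ker_rangeRestrict])) ?_ hq
  rw [← LinearMap.range_eq_top, Submodule.range_liftQ, LinearMap.range_rangeRestrict]

end IsWeaklyLaskerian

/-! ### Torsion submodules -/

theorem map_quotient_mem_gammaTorsion {R : Type*} [CommRing R] (a : Ideal R) {M : Type*}
    [AddCommGroup M] [Module R M] (f : (R ⧸ a) →ₗ[R] M) (x : R ⧸ a) : f x ∈ gammaTorsion a M := by
  refine ⟨1, fun r hr => ?_⟩
  obtain ⟨y, rfl⟩ := Ideal.Quotient.mk_surjective x
  rw [pow_one] at hr
  rw [← map_smul, Algebra.smul_def, Ideal.Quotient.algebraMap_eq,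
    Ideal.Quotient.eq_zero_iff_mem.2 hr, zero_mul, map_zero]

/-- Over a Noetherian ring, the torsion submodule of an injective module is injective. -/
theorem baer_gammaTorsion {R : Type u} [CommRing R] [IsNoetherianRing R] (a : Ideal R)
    {E : Type u} [AddCommGroup E] [Module R E] (hE : Module.Injective R E) :
    Module.Baer R (gammaTorsion a E) := by
  intro J f
  obtain ⟨k, hk⟩ : ∃ k : ℕ, ∀ r ∈ a ^ k, ∀ x : J, r • f x = 0 := by
    obtain ⟨s, hs⟩ := (Module.finite_def (R := R) (M := J)).1 inferInstance
    choose e he using fun x : J => (f x).2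
    refine ⟨s.sup e, fun r hr x => ?_⟩
    have hx : x ∈ Submodule.span R (s : Set J) := hs ▸ Submodule.mem_top
    induction hx using Submodule.span_induction with
    | mem x hx =>
      exact Subtype.ext (he x r (Ideal.pow_le_pow_right (Finset.le_sup hx) hr))
    | zero => simp
    | add x y _ _ hx hy => rw [map_add, smul_add, hx, hy, add_zero]
    | smul c x _ hx => rw [map_smul, smul_comm, hx, smul_zero]
  -- Artin–Rees: J ∩ a^(m+k) ⊆ a^k J, which `f` kills, so `f` factors through a submodule of
  -- R/a^(m+k).
  obtain ⟨m, hm⟩ := a.exists_pow_inf_eq_pow_smul J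
  have key : ∀ x : J, (x : R) ∈ a ^ (m + k) → f x = 0 := by
    intro x hx
    have hx' : (x : R) ∈ a ^ (m + k) • (⊤ : Submodule R R) ⊓ J := ⟨by simpa using hx, x.2⟩
    rw [hm _ (Nat.le_add_right m k), Nat.add_sub_cancel_left] at hx'
    have hx2 : (x : R) ∈ (a ^ k • (⊤ : Submodule R J)).map J.subtype := by
      rw [Submodule.map_smul'', Submodule.map_top, Submodule.range_subtype]
      exact Submodule.smul_mono le_rfl inf_le_right hx'
    obtain ⟨y, hy, hyx⟩ := hx2
    obtain rfl : y = x := Subtype.ext hyx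
    refine Submodule.smul_induction_on hy (p := fun y => f y = 0) (fun r hr z _ => ?_)
      fun y z hy hz => ?_
    · rw [map_smul, hk r hr]
    · rw [map_add, hy, hz, add_zero]
  let i := Submodule.mapQ (Submodule.comap J.subtype (a ^ (m + k))) (a ^ (m + k)) J.subtype le_rfl
  have hi : Function.Injective i := by
    rw [← LinearMap.ker_eq_bot, Submodule.ker_mapQ, Submodule.mkQ_map_self]
  -- Extending to R/a^(m+k) rather than to `R` forces torsion values.
  obtain ⟨g, hg⟩ := hE.out i hi (Submodule.liftQ (Submodule.comap J.subtype (a ^ (m + k)))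
    ((gammaTorsion a E).subtype ∘ₗ f) fun x hx => by simp [key x hx])
  have hmem : ∀ r : R, g (Submodule.Quotient.mk r) ∈ gammaTorsion a E := fun r =>
    ⟨m + k, fun s hs => by
      rw [← map_smul, ← Submodule.Quotient.mk_smul, smul_eq_mul,
        (Submodule.Quotient.mk_eq_zero _).2 (Ideal.mul_mem_right r _ hs), map_zero]⟩
  refine ⟨(g ∘ₗ Submodule.mkQ (a ^ (m + k))).codRestrict _ hmem, fun x hx => Subtype.ext ?_⟩
  exact hg (Submodule.Quotient.mk ⟨x, hx⟩)

/-- If every element of `M` is `a`-torsion, then `M` and `Hom(R/a, M)` have the same associated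
primes. -/
theorem associatedPrimes_subset_hom_of_torsion {R : Type*} [CommRing R] [IsNoetherianRing R]
    (a : Ideal R) {M : Type*} [AddCommGroup M] [Module R M] (hM : gammaTorsion a M = ⊤) :
    associatedPrimes R M ⊆ associatedPrimes R ((R ⧸ a) →ₗ[R] M) := by
  intro p hp
  have hp' := hp
  rw [AssociatedPrimes.mem_iff, isAssociatedPrime_iff_exists_injective_linearMap] at hp'
  obtain ⟨hprime, f, hf⟩ := hp'
  have hap : a ≤ p := by
    obtain ⟨k, hk⟩ := (hM ▸ Submodule.mem_top : f (Ideal.Quotient.mk p 1) ∈ gammaTorsion a M)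
    refine hprime.le_of_pow_le (n := k) fun r hr => ?_
    have h0 := hk r hr
    rw [← map_smul, ← map_zero f] at h0
    have h1 := hf h0
    rwa [Algebra.smul_def, Ideal.Quotient.algebraMap_eq, ← map_mul, mul_one,
      Ideal.Quotient.eq_zero_iff_mem] at h1
  -- `x` goes to the map `y ↦ f (x * q y)`; evaluation at 1 shows injectivity.
  have hA : associatedPrimes R (R ⧸ p) ⊆ associatedPrimes R ((R ⧸ a) →ₗ[R] M) := by
    let q : (R ⧸ a) →ₗ[R] (R ⧸ p) := Submodule.mapQ a p LinearMap.id hap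
    refine associatedPrimes.subset_of_injective (f :=
      (LinearMap.lcomp R M q) ∘ₗ (LinearMap.llcomp R (R ⧸ p) (R ⧸ p) M f) ∘ₗ
        (LinearMap.mul R (R ⧸ p))) ?_
    intro x y hxy
    have h1 := LinearMap.congr_fun hxy (Ideal.Quotient.mk a 1)
    have h2 : q (Ideal.Quotient.mk a 1) = 1 := rfl
    simp only [LinearMap.comp_apply, LinearMap.lcomp_apply, LinearMap.llcomp_apply, h2,
      LinearMap.mul_apply', mul_one] at h1
    exact hf h1
  apply hA
  rw [AssociatedPrimes.mem_iff, isAssociatedPrime_iff_exists_injective_linearMap]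
  exact ⟨hprime, LinearMap.id, Function.injective_id⟩

/-! ### Long exact sequences of Ext -/

open Abelian in
/-- `Ext^k(A, M)` is weakly Laskerian. -/
def ExtWeaklyLaskerian {R : Type u} [CommRing R] (A : ModuleCat.{u} R) (k : ℕ)
    (M : ModuleCat.{u} R) : Prop :=
  IsWeaklyLaskerian R (Ext.{u} A M k)

namespace ExtWeaklyLaskerian

open Abelian

variable {R : Type u} [CommRing R] {A : ModuleCat.{u} R} {k : ℕ}

theorem of_iso {M N : ModuleCat.{u} R} (e : M ≅ N) (h : ExtWeaklyLaskerian A k M) :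
    ExtWeaklyLaskerian A k N := by
  refine IsWeaklyLaskerian.of_injective
    ((Ext.mk₀ e.inv).postcompOfLinear R A (add_zero k)) ?_ h
  refine Function.LeftInverse.injective (g := (Ext.mk₀ e.hom).postcompOfLinear R A (add_zero k)) ?_
  intro x
  simp [Ext.bilinearCompOfLinear_apply_apply]

theorem of_subsingleton {M : ModuleCat.{u} R} [Subsingleton M] : ExtWeaklyLaskerian A k M := by
  have : Subsingleton (Ext.{u} A M k) := by
    refine subsingleton_of_forall_eq 0 fun x => ?_
    have h : (𝟙 M : M ⟶ M) = 0 := by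
      ext y
      exact Subsingleton.elim _ _
    rw [← x.comp_mk₀_id, h, Ext.mk₀_zero, Ext.comp_zero]
  exact IsWeaklyLaskerian.of_subsingleton

variable {S : ShortComplex (ModuleCat.{u} R)} (hS : S.ShortExact)

include hS in
theorem of_shortExact (h₁ : ExtWeaklyLaskerian A k S.X₁) (h₃ : ExtWeaklyLaskerian A k S.X₃) :
    ExtWeaklyLaskerian A k S.X₂ := by
  refine IsWeaklyLaskerian.of_exact
    (f := (Ext.mk₀ S.f).postcompOfLinear R A (add_zero k))
    (g := (Ext.mk₀ S.g).postcompOfLinear R A (add_zero k)) ?_ h₁ h₃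
  intro x
  refine ⟨fun hx => Ext.covariant_sequence_exact₂ A hS x hx, ?_⟩
  rintro ⟨y, rfl⟩
  simp

include hS in
/-- Dimension shifting along an injective middle term. -/
theorem of_injective_middle [Injective S.X₂] (h : ExtWeaklyLaskerian A (k + 2) S.X₁) :
    ExtWeaklyLaskerian A (k + 1) S.X₃ := by
  refine IsWeaklyLaskerian.of_injective
    (hS.extClass.postcompOfLinear R A (b := k + 2) rfl) ?_ h
  rw [← LinearMap.ker_eq_bot, LinearMap.ker_eq_bot']
  intro x hx
  obtain ⟨y, rfl⟩ := Ext.covariant_sequence_exact₃ A hS x rfl hx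
  rw [Ext.eq_zero_of_injective y, Ext.zero_comp]

include hS in
/-- `Hom(A, S.X₃)` is weakly Laskerian as soon as `Ext¹(A, S.X₁)` is and `Hom(A, S.X₂)` admits a
linear map to a weakly Laskerian module whose kernel dies in `Hom(A, S.X₃)`. -/
theorem hom_of_ker_le {W : Type*} [AddCommGroup W] [Module R W] (hW : IsWeaklyLaskerian R W)
    (θ : Ext.{u} A S.X₂ 0 →ₗ[R] W)
    (hθ : ∀ f : A ⟶ S.X₂, θ (Ext.mk₀ f) = 0 → f ≫ S.g = 0)
    (h₁ : ExtWeaklyLaskerian A 1 S.X₁) : ExtWeaklyLaskerian A 0 S.X₃ := by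
  let φ := (Ext.mk₀ S.g).postcompOfLinear R A (add_zero 0)
  have hφ : IsWeaklyLaskerian R (LinearMap.range φ) := by
    refine IsWeaklyLaskerian.range_of_ker_le (θ := θ) (fun x hx => ?_) hW
    obtain ⟨f, rfl⟩ := Ext.addEquiv₀.symm.surjective x
    change (Ext.mk₀ f).comp (Ext.mk₀ S.g) (add_zero 0) = 0
    rw [Ext.mk₀_comp_mk₀, hθ f hx, Ext.mk₀_zero]
  refine IsWeaklyLaskerian.of_exact (f := (LinearMap.range φ).subtype)
    (g := hS.extClass.postcompOfLinear R A (zero_add 1)) ?_ hφ h₁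
  intro x
  constructor
  · intro hx
    obtain ⟨y, hy⟩ := Ext.covariant_sequence_exact₃ A hS x (zero_add 1) hx
    exact ⟨⟨x, y, hy⟩, rfl⟩
  · rintro ⟨⟨_, y, rfl⟩, rfl⟩
    simp [φ]

end ExtWeaklyLaskerian

section ShortExact

variable {R : Type u} [CommRing R] {M N : ModuleCat.{u} R}

/-- The short complex `ker f → M → range f`. -/
abbrev kerRangeShortComplex (f : M ⟶ N) : ShortComplex (ModuleCat.{u} R) :=
  ShortComplex.mk (X₁ := .of R (LinearMap.ker f.hom)) (X₂ := M)
    (X₃ := .of R (LinearMap.range f.hom))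
    (ModuleCat.ofHom (LinearMap.ker f.hom).subtype) (ModuleCat.ofHom f.hom.rangeRestrict) (by
      ext x
      exact x.2)

theorem kerRangeShortComplex_shortExact (f : M ⟶ N) : (kerRangeShortComplex f).ShortExact := by
  refine ModuleCat.shortComplex_shortExact _ (fun x => ?_) Subtype.val_injective
    f.hom.surjective_rangeRestrict
  constructor
  · intro hx
    exact ⟨⟨x, congrArg Subtype.val hx⟩, rfl⟩
  · rintro ⟨y, rfl⟩
    exact Subtype.ext y.2

/-- The short complex `p → q → q / p` for submodules `p ≤ q`. -/
abbrev submoduleShortComplex {p q : Submodule R M} (h : p ≤ q) :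
    ShortComplex (ModuleCat.{u} R) :=
  ShortComplex.mk (X₁ := .of R p) (X₂ := .of R q) (X₃ := .of R (q ⧸ p.submoduleOf q))
    (ModuleCat.ofHom (Submodule.inclusion h)) (ModuleCat.ofHom (p.submoduleOf q).mkQ) (by
      ext x
      exact (Submodule.Quotient.mk_eq_zero _).2 x.2)

theorem submoduleShortComplex_shortExact {p q : Submodule R M} (h : p ≤ q) :
    (submoduleShortComplex h).ShortExact := by
  refine ModuleCat.shortComplex_shortExact _ (fun x => ?_) (Submodule.inclusion_injective h)
    (Submodule.mkQ_surjective _)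
  constructor
  · intro hx
    exact ⟨⟨x.1, (Submodule.Quotient.mk_eq_zero (p.submoduleOf q)).1 hx⟩, rfl⟩
  · rintro ⟨y, rfl⟩
    exact (Submodule.Quotient.mk_eq_zero _).2 y.2

end ShortExact

/-! ### Coboundaries of a complex of injectives -/

namespace CochainComplex

variable {R : Type u} [CommRing R] (D : CochainComplex (ModuleCat.{u} R) ℕ)

/-- The submodule of cocycles in degree `n`. -/
abbrev cocycles (n : ℕ) : Submodule R (D.X n) := LinearMap.ker (D.d n (n + 1)).hom

/-- The submodule of coboundaries in degree `n`. -/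
noncomputable abbrev coboundaries (n : ℕ) : Submodule R (D.X n) :=
  LinearMap.range (D.d ((ComplexShape.up ℕ).prev n) n).hom

theorem coboundaries_le_cocycles (n : ℕ) : D.coboundaries n ≤ D.cocycles n := by
  rintro _ ⟨x, rfl⟩
  exact congr($(D.d_comp_d ((ComplexShape.up ℕ).prev n) n (n + 1)) x)

theorem coboundaries_succ (n : ℕ) :
    D.coboundaries (n + 1) = LinearMap.range (D.d n (n + 1)).hom := by
  unfold coboundaries
  rw [CochainComplex.prev_nat_succ]

instance subsingleton_coboundaries_zero : Subsingleton (D.coboundaries 0) := by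
  -- `prev 0` defaults to `0`, and the differential from 0 to 0 vanishes.
  have h : D.d ((ComplexShape.up ℕ).prev 0) 0 = 0 := D.shape _ _ (by simp)
  rw [Submodule.subsingleton_iff_eq_bot, coboundaries, h]
  exact LinearMap.range_zero

/-- The cohomology of a complex of modules is cocycles modulo coboundaries. -/
noncomputable def homologyIsoQuotient (n : ℕ) :
    D.homology n ≅
      ModuleCat.of R (D.cocycles n ⧸ (D.coboundaries n).submoduleOf (D.cocycles n)) :=
  D.homologyIsoSc' ((ComplexShape.up ℕ).prev n) n (n + 1) rfl (by simp) ≪≫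
    (D.sc' _ _ _).moduleCatHomologyIso ≪≫
    (Submodule.quotEquivOfEq _ _ (by
      ext x
      constructor
      · rintro ⟨y, rfl⟩
        exact ⟨y, rfl⟩
      · rintro ⟨y, hy⟩
        exact ⟨y, Subtype.ext hy⟩)).toModuleIso

open ExtWeaklyLaskerian

/-- The Ext modules of the coboundaries of a complex of injective modules are controlled by those
of its cohomology in lower degrees. -/
theorem extWeaklyLaskerian_coboundaries {A : ModuleCat.{u} R} (hD : ∀ j, Injective (D.X j))
    {n : ℕ} (h : ∀ i < n, ExtWeaklyLaskerian A (n + 1 - i) (D.homology i)) :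
    ∀ m ≤ n, ExtWeaklyLaskerian A (n + 1 - m) (.of R (D.coboundaries m))
  | 0, _ => of_subsingleton
  | m + 1, hm => by
    -- This turns the truncated subtractions into successors: Ext^(k+2) of Z^m controls Ext^(k+1) of
    -- B^(m+1).
    obtain ⟨k, rfl⟩ : ∃ k, n = m + 1 + k := Nat.exists_eq_add_of_le hm
    have hB := extWeaklyLaskerian_coboundaries hD h m (by lia)
    have hH := (h m (by lia)).of_iso (D.homologyIsoQuotient m)
    have hZ := of_shortExact (submoduleShortComplex_shortExact (D.coboundaries_le_cocycles m)) hB hH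
    rw [show m + 1 + k + 1 - m = k + 2 by lia] at hZ
    rw [show m + 1 + k + 1 - (m + 1) = k + 1 by lia, coboundaries_succ]
    have := hD m
    exact of_injective_middle (kerRangeShortComplex_shortExact (D.d m (m + 1))) hZ

end CochainComplex

/-! ### Local cohomology through injective resolutions -/

section

variable {R : Type u} [CommRing R]

theorem injective_gammaFunctor_obj [IsNoetherianRing R] (a : Ideal R) (E : ModuleCat.{u} R)
    [Injective E] : Injective ((gammaFunctor a).obj E) :=
  have hE : Module.Injective R E :=
    Module.injective_module_of_injective_object R E (inj := ‹Injective E›)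
  Module.injective_object_of_injective_module R (gammaTorsion a E)
    (inj := (baer_gammaTorsion a hE).injective)

/-- The `a`-torsion subcomplex of a complex of modules. -/
noncomputable abbrev gammaComplex (a : Ideal R) (C : CochainComplex (ModuleCat.{u} R) ℕ) :
    CochainComplex (ModuleCat.{u} R) ℕ :=
  ((gammaFunctor a).mapHomologicalComplex _).obj C

/-- Local cohomology is the cohomology of the torsion subcomplex of an injective resolution. -/
noncomputable def localCohomologyIso (a : Ideal R) {X : ModuleCat.{u} R}
    (I : InjectiveResolution X) (n : ℕ) :
    localCohomologyModule a n X ≅ (gammaComplex a I.cocomplex).homology n :=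
  I.isoRightDerivedObj (gammaFunctor a) n

theorem gammaTorsion_localCohomologyModule (a : Ideal R) (X : ModuleCat.{u} R) (n : ℕ) :
    gammaTorsion a (localCohomologyModule a n X) = ⊤ := by
  let D := gammaComplex a (injectiveResolution X).cocomplex
  let e := (localCohomologyIso a (injectiveResolution X) n ≪≫
    D.homologyIsoQuotient n).toLinearEquiv
  rw [eq_top_iff]
  intro x _
  obtain ⟨y, rfl⟩ := e.symm.surjective x
  obtain ⟨⟨⟨z, k, hk⟩, hz⟩, rfl⟩ := Submodule.mkQ_surjective _ y
  refine ⟨k, fun r hr => ?_⟩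
  rw [← map_smul, ← map_smul]
  have h0 : r • (⟨⟨z, k, hk⟩, hz⟩ : D.cocycles n) = 0 :=
    Subtype.ext (Subtype.ext (hk r hr))
  rw [h0, map_zero, map_zero]

namespace CategoryTheory.InjectiveResolution

variable {X : ModuleCat.{u} R} (I : InjectiveResolution X)

theorem cocycles_succ (n : ℕ) :
    I.cocomplex.cocycles (n + 1) = LinearMap.range (I.cocomplex.d n (n + 1)).hom :=
  ((I.exact_succ n).moduleCat_range_eq_ker).symm

/-- The zeroth cosyzygy of an injective resolution of `X` is `X`. -/
noncomputable def cocyclesZeroIso : X ≅ .of R (I.cocomplex.cocycles 0) :=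
  (HomologicalComplex.singleObjXSelf (ComplexShape.up ℕ) 0 X).symm ≪≫
    ((LinearEquiv.ofInjective (I.ι.f 0).hom
      ((ModuleCat.mono_iff_injective _).1 inferInstance)).trans
        (LinearEquiv.ofEq _ _ I.exact₀.moduleCat_range_eq_ker)).toModuleIso

/-- Dimension shifting along an injective resolution. -/
theorem extWeaklyLaskerian_cocycles {A : ModuleCat.{u} R} :
    ∀ (n k : ℕ), ExtWeaklyLaskerian A (n + k + 1) X →
      ExtWeaklyLaskerian A (k + 1) (.of R (I.cocomplex.cocycles n))
  | 0, k, h => by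
    rw [zero_add] at h
    exact h.of_iso I.cocyclesZeroIso
  | n + 1, k, h => by
    rw [cocycles_succ]
    have h' := extWeaklyLaskerian_cocycles n (k + 1) (by rwa [show n + (k + 1) = n + 1 + k by lia])
    exact h'.of_injective_middle (kerRangeShortComplex_shortExact (I.cocomplex.d n (n + 1)))

end CategoryTheory.InjectiveResolution

open Abelian in
/-- The `Hom` module of local cohomology, expressed through `Ext`. -/
theorem extWeaklyLaskerian_zero_localCohomologyModule [IsNoetherianRing R] (a : Ideal R)
    (X : ModuleCat.{u} R) (n : ℕ) (hX : ExtWeaklyLaskerian (ModuleCat.of R (R ⧸ a)) n X)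
    (hH : ∀ i < n, ExtWeaklyLaskerian (ModuleCat.of R (R ⧸ a)) (n + 1 - i)
      (localCohomologyModule a i X)) :
    ExtWeaklyLaskerian (ModuleCat.of R (R ⧸ a)) 0 (localCohomologyModule a n X) := by
  let I := injectiveResolution X
  let D := gammaComplex a I.cocomplex
  have hB : ExtWeaklyLaskerian (ModuleCat.of R (R ⧸ a)) 1 (.of R (D.coboundaries n)) := by
    have h := D.extWeaklyLaskerian_coboundaries
      (fun j => injective_gammaFunctor_obj a (I.cocomplex.X j))
      (fun i hi => (hH i hi).of_iso (localCohomologyIso a I i)) n le_rfl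
    rwa [Nat.add_sub_cancel_left] at h
  refine ExtWeaklyLaskerian.of_iso
    (localCohomologyIso a I n ≪≫ D.homologyIsoQuotient n).symm ?_
  have hS := submoduleShortComplex_shortExact (D.coboundaries_le_cocycles n)
  let i : ModuleCat.of R (D.cocycles n) ⟶ ModuleCat.of R (I.cocomplex.cocycles n) :=
    ModuleCat.ofHom (((gammaTorsion a (I.cocomplex.X n)).subtype ∘ₗ
      (D.cocycles n).subtype).codRestrict _ fun x => congrArg Subtype.val x.2)
  cases n with
  | zero =>
    refine ExtWeaklyLaskerian.hom_of_ker_le hS (hX.of_iso I.cocyclesZeroIso)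
      ((Ext.mk₀ i).postcompOfLinear R _ (add_zero 0)) (fun f hf => ?_) hB
    -- In degree 0 no lifting is needed: Hom(R/a, Z⁰) embeds in Hom(R/a, X).
    have : Mono i := (ModuleCat.mono_iff_injective i).2 fun _ _ hxy =>
      Subtype.ext (Subtype.ext (Subtype.ext_iff.1 hxy :))
    have hf' : f ≫ i = 0 := by
      change (Ext.mk₀ f).comp (Ext.mk₀ i) (add_zero 0) = 0 at hf
      rwa [Ext.mk₀_comp_mk₀, Ext.mk₀_eq_zero_iff] at hf
    rw [Limits.zero_of_comp_mono i hf', Limits.zero_comp]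
  | succ m =>
    have hT := kerRangeShortComplex_shortExact (I.cocomplex.d m (m + 1))
    let j : ModuleCat.of R (D.cocycles (m + 1)) ⟶
        ModuleCat.of R (LinearMap.range (I.cocomplex.d m (m + 1)).hom) :=
      i ≫ (LinearEquiv.ofEq _ _ (I.cocycles_succ m)).toModuleIso.hom
    -- Here `θ` is the connecting map into Ext¹ of the `m`-th cocycles of `I`, controlled by
    -- Ext^(m+1)(R/a, X).
    refine ExtWeaklyLaskerian.hom_of_ker_le hS (I.extWeaklyLaskerian_cocycles m 0 hX)
      ((hT.extClass).postcompOfLinear R _ (zero_add 1) ∘ₗ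
        (Ext.mk₀ j).postcompOfLinear R _ (add_zero 0)) (fun f hf => ?_) hB
    change ((Ext.mk₀ f).comp (Ext.mk₀ j) (add_zero 0)).comp hT.extClass (zero_add 1) = 0 at hf
    obtain ⟨y, hy⟩ := Ext.covariant_sequence_exact₃ _ hT _ (zero_add 1) hf
    obtain ⟨g, rfl⟩ := Ext.addEquiv₀.symm.surjective y
    change (Ext.mk₀ g).comp _ _ = _ at hy
    rw [Ext.mk₀_comp_mk₀, Ext.mk₀_comp_mk₀] at hy
    have hgf := (Ext.mk₀_bijective _ _).1 hy
    refine ModuleCat.hom_ext (LinearMap.ext fun x => ?_)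
    refine (Submodule.Quotient.mk_eq_zero _).2 ?_
    change (f x).1 ∈ D.coboundaries (m + 1)
    refine (D.coboundaries_succ m).ge ?_
    -- The lift `g` takes torsion values, so `f x` is a coboundary in `D`, not only in `I`.
    refine ⟨⟨g x, map_quotient_mem_gammaTorsion a g.hom x⟩, Subtype.ext ?_⟩
    have hx := congr($hgf x)
    exact (Subtype.ext_iff.1 hx :)

end

theorem corollary2p5 {R : Type u} [CommRing R] [IsNoetherianRing R] (a : Ideal R)
    (X : ModuleCat.{u} R) (n : ℕ)
    (hX : IsWeaklyLaskerian R (Abelian.Ext.{u} (ModuleCat.of R (R ⧸ a)) X n))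
    (hH : ∀ i < n, IsWeaklyLaskerian R
      (Abelian.Ext.{u} (ModuleCat.of R (R ⧸ a)) (localCohomologyModule a i X) (n + 1 - i))) :
    IsWeaklyLaskerian R ((R ⧸ a) →ₗ[R] localCohomologyModule a n X) ∧
      (associatedPrimes R (localCohomologyModule a n X)).Finite := by
  have hHom : IsWeaklyLaskerian R ((R ⧸ a) →ₗ[R] localCohomologyModule a n X) := by
    let e := ModuleCat.homLinearEquiv (S := R) (M := ModuleCat.of R (R ⧸ a))
      (N := localCohomologyModule a n X)
    let e' := (Abelian.Ext.linearEquiv₀ (R := R)).trans e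
    exact IsWeaklyLaskerian.of_surjective e'.toLinearMap e'.surjective
      (extWeaklyLaskerian_zero_localCohomologyModule a X n hX hH)
  refine ⟨hHom, (hHom ⊥).subset ?_⟩
  rw [LinearEquiv.AssociatedPrimes.eq (Submodule.quotEquivOfEqBot (⊥ : Submodule R _) rfl)]
  exact associatedPrimes_subset_hom_of_torsion a (gammaTorsion_localCohomologyModule a X n)
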